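/- Let $(A,\mathfrak m)$ and $(R,\mathfrak n)$ be Noetherian local rings and let $A\to R$ be a flat local homomorphism. Put $k=A/\mathfrak m$ and $K=R/\mathfrak n$. Suppose that the (not necessarily algebraic) field extension $K/k$ is separable, i.e. $K\otimes_k k'$ is reduced for every field extension $k'$ of $k$ (equivalently, $K\otimes_k\bar k$ is reduced, where $\bar k$ is an algebraic closure of $k$), and that $R\otimes_A k$ is a regular ring of Krull dimension $n$, $n\ge 0$. Let $(B,J)$ be a Noetherian local ring and $A\to B$ a flat local homomorphism such that $\mathfrak mB=J$ and $B/J$ is isomorphic to $K$ as a $k$-algebra. Then there is an isomorphism of $A$-algebras $\hat R\cong \hat B[[T_1,\dots,T_n]]$, where $\hat R$ is the $\mathfrak n$-adic completion of $R$ and $\hat B$ is the $J$-adic completion of $B$. -/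

import Mathlib

open scoped TensorProduct

open scoped TensorProduct

/-! The separable extension `K/k` is formally smooth. Since `B` is flat over `A` and `B/mB = K`, the
map `B → K = R/n` lifts over `A` through the quotients `R/n^i`, giving `ψ : B → R̂`. Choose `t_1, …,
t_n` in `R` whose images form a regular system of parameters of the fibre `R/mR`. The isomorphism is
the evaluation of power series over `B̂` that extends `ψ` and sends `T_i` to `t_i`.

It is surjective by successive approximation, because `n = mR + (t)` and `B` surjects onto `K`.

For injectivity let `S = B̂[[T]]` and let `N` be the kernel. Regular parameters of the fibre are
analytically independent, so comparing leading forms puts all coefficients of an element of `N` in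
`mB̂`, that is, `N ⊆ mS`. As `R̂` is flat over `A`, `N ∩ mS = mN` (`Module.Flat.mem_map_mul_ker`).
So `N = mN` lies in every `m^i S`, and these intersect in zero. -/

/-! ### Separable field extensions are formally smooth. -/

/-- Mac Lane's criterion: with `c x` a `p`-th root of the coefficient `f x` of a relation between
the `x ^ p`, the tensor `∑ c x ⊗ x` has `p`-th power zero, so it vanishes in a reduced ring. -/
theorem linearIndepOn_pow_of_isGeometricallyReduced (k : Type*) {K : Type*} [Field k] [Field K]
    [Algebra k K] [Algebra.IsGeometricallyReduced k K] (p : ℕ) [hp : Fact p.Prime] [CharP k p]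
    (s : Finset K) (hs : LinearIndepOn k _root_.id (s : Set K)) :
    LinearIndepOn k (· ^ p) (s : Set K) := by
  have hred := (Algebra.isGeometricallyReduced_field_iff k K).mp ‹_›
  have : CharP (AlgebraicClosure k) p := charP_of_injective_algebraMap (algebraMap k _).injective p
  rw [linearIndepOn_finset_iff]
  intro f hf
  have hroot : ∀ x : K, ∃ c : AlgebraicClosure k, c ^ p = algebraMap k _ (f x) := fun x ↦
    IsAlgClosed.exists_pow_nat_eq _ hp.out.pos
  choose c hc using hroot
  have : CharP (AlgebraicClosure k ⊗[k] K) p :=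
    charP_of_injective_algebraMap (algebraMap k _).injective p
  have hz : ∑ x ∈ s, c x ⊗ₜ[k] x = 0 := by
    apply IsReduced.eq_zero
    refine ⟨p, ?_⟩
    rw [sum_pow_char]
    simp only [Algebra.TensorProduct.tmul_pow, hc]
    calc ∑ x ∈ s, (algebraMap k (AlgebraicClosure k) (f x)) ⊗ₜ[k] (x ^ p)
        = (1 : AlgebraicClosure k) ⊗ₜ[k] ∑ x ∈ s, f x • (x ^ p) := by
          rw [TensorProduct.tmul_sum]
          refine Finset.sum_congr rfl fun x _ ↦ ?_
          rw [Algebra.algebraMap_eq_smul_one, TensorProduct.smul_tmul]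
      _ = 0 := by rw [hf, TensorProduct.tmul_zero]
  have hli : LinearIndependent (AlgebraicClosure k)
      (fun x : s ↦ (1 : AlgebraicClosure k) ⊗ₜ[k] (x : K)) :=
    Module.Flat.linearIndependent_one_tmul hs
  intro x hx
  have := Fintype.linearIndependent_iff.mp hli (fun x ↦ c x) (by
    rw [← hz, ← Finset.sum_coe_sort s]
    refine Finset.sum_congr rfl fun y _ ↦ ?_
    rw [TensorProduct.smul_tmul', smul_eq_mul, mul_one]) ⟨x, hx⟩
  have h2 := hc x
  simp only at this
  rw [this, zero_pow hp.out.ne_zero, eq_comm, map_eq_zero] at h2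
  exact h2

theorem Algebra.FormallySmooth.of_isGeometricallyReduced_of_essFiniteType (k K : Type*) [Field k]
    [Field K] [Algebra k K] [Algebra.IsGeometricallyReduced k K] [Algebra.EssFiniteType k K] :
    Algebra.FormallySmooth k K := by
  obtain _ | ⟨p, hp, hpk⟩ := CharP.exists' k
  · infer_instance
  · have : ExpChar k p := .prime hp.out
    obtain ⟨s, hs, H⟩ :=
      exists_isTranscendenceBasis_and_isSeparable_of_linearIndepOn_pow_of_essFiniteType p hp.out
        (fun s hs ↦ linearIndepOn_pow_of_isGeometricallyReduced k (K := K) p s hs)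
    have : Algebra.IsSeparable (IntermediateField.adjoin k (Set.range ((↑) : s → K))) K := by
      convert! H <;> simp
    exact .of_algebraicIndependent_of_isSeparable hs.1

/-- With all elements of `S` as generators and `I` the ideal of relations, `H_1` is the kernel of
`I/I² → ⊕ S dX_i`. Each instance of the condition involves one polynomial, hence finitely many
elements of `S`, which permits reduction to finitely generated subextensions. -/
theorem Algebra.subsingleton_h1Cotangent_iff_forall_pderiv (R S : Type*) [CommRing R] [CommRing S]
    [Algebra R S] : Subsingleton (Algebra.H1Cotangent R S) ↔
      ∀ x : MvPolynomial S R, MvPolynomial.aeval _root_.id x = (0 : S) →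
        (∀ i, MvPolynomial.aeval _root_.id (MvPolynomial.pderiv i x) = (0 : S)) →
        x ∈ RingHom.ker (MvPolynomial.aeval (R := R) (_root_.id : S → S)) ^ 2 := by
  let P := Generators.self R S
  have hker : P.toExtension.ker = RingHom.ker (MvPolynomial.aeval (R := R) (_root_.id : S → S)) := by
    ext x
    exact Iff.of_eq (congrArg (· = (0 : S)) (by rfl))
  change Subsingleton P.toExtension.H1Cotangent ↔ _
  rw [Algebra.Extension.subsingleton_h1Cotangent, injective_iff_map_eq_zero]
  have hcc (x : P.toExtension.ker) : P.toExtension.cotangentComplex (.mk x) = 0 ↔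
      ∀ i, MvPolynomial.aeval _root_.id (MvPolynomial.pderiv i (show MvPolynomial S R from x.1)) = (0 : S) := by
    rw [Algebra.Extension.cotangentComplex_mk, ← P.cotangentSpaceBasis.repr.map_eq_zero_iff,
      Finsupp.ext_iff]
    refine forall_congr' fun i ↦ ?_
    erw [P.cotangentSpaceBasis_repr_tmul]
    rw [one_mul]
    rfl
  constructor
  · intro H x hx hd
    have hx' : x ∈ P.toExtension.ker := by rw [hker]; exact hx
    have := H (.mk ⟨x, hx'⟩) ((hcc _).mpr hd)
    rw [Algebra.Extension.Cotangent.mk_eq_zero_iff] at this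
    rw [← hker]
    exact this
  · intro H y hy
    obtain ⟨x, rfl⟩ := Algebra.Extension.Cotangent.mk_surjective y
    have hker2 : P.toExtension.ker ^ 2 = _ := congrArg (· ^ 2) hker
    rw [Algebra.Extension.Cotangent.mk_eq_zero_iff, hker2]
    have hx : x.1 ∈ RingHom.ker (MvPolynomial.aeval (R := R) (_root_.id : S → S)) := hker ▸ x.2
    exact H x.1 hx ((hcc x).mp hy)

/-- A field extension is formally smooth as soon as all its finitely generated subextensions
are. -/
theorem Algebra.FormallySmooth.of_forall_adjoin_finset (k K : Type*) [Field k] [Field K]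
    [Algebra k K]
    (H : ∀ s : Finset K, Algebra.FormallySmooth k (IntermediateField.adjoin k (s : Set K))) :
    Algebra.FormallySmooth k K := by
  -- Differentials form a vector space over `K`, hence a projective module; only `H_1 = 0` remains.
  refine ⟨inferInstance, ?_⟩
  rw [Algebra.subsingleton_h1Cotangent_iff_forall_pderiv]
  intro x hx hd
  classical
  let L := IntermediateField.adjoin k (x.vars : Set K)
  have hL := (Algebra.subsingleton_h1Cotangent_iff_forall_pderiv k L).mp (H x.vars).2
  -- The value 0 off `x.vars` is never seen by `x`; it only makes `g` total.
  let g : K → L := fun a ↦ if h : a ∈ x.vars then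
    ⟨a, IntermediateField.subset_adjoin _ _ h⟩ else 0
  let y := MvPolynomial.rename g x
  have hyx : MvPolynomial.rename (Subtype.val : L → K) y = x := by
    rw [MvPolynomial.rename_rename]
    conv_rhs => rw [← MvPolynomial.rename_id_apply (p := x)]
    refine MvPolynomial.hom_congr_vars (by ext; simp) (fun i hi _ ↦ ?_) rfl
    simp [g, hi]
  have hval (z : MvPolynomial L k) : ((MvPolynomial.aeval _root_.id z : L) : K) =
      MvPolynomial.aeval _root_.id (MvPolynomial.rename (Subtype.val : L → K) z) := by
    rw [MvPolynomial.aeval_rename]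
    exact (MvPolynomial.aeval_algebraMap_apply K (_root_.id : L → L) z).symm
  have hy := hL y (Subtype.val_injective (by rw [hval, hyx, hx]; rfl)) (fun i ↦
    Subtype.val_injective (by
      rw [hval, ← MvPolynomial.pderiv_rename Subtype.val_injective, hyx, hd]; rfl))
  rw [← hyx]
  have hmap := Ideal.mem_map_of_mem (MvPolynomial.rename (R := k) (Subtype.val : L → K)) hy
  rw [Ideal.map_pow] at hmap
  refine Ideal.pow_right_mono ?_ 2 hmap
  rw [Ideal.map_le_iff_le_comap]
  intro z hz
  rw [Ideal.mem_comap, RingHom.mem_ker, ← hval, (RingHom.mem_ker).mp hz]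
  rfl

/-- A separable, not necessarily algebraic, field extension is formally smooth. -/
theorem Algebra.FormallySmooth.of_isGeometricallyReduced (k K : Type*) [Field k] [Field K]
    [Algebra k K] [Algebra.IsGeometricallyReduced k K] : Algebra.FormallySmooth k K := by
  refine .of_forall_adjoin_finset k K fun s ↦ ?_
  have : Algebra.IsGeometricallyReduced k (IntermediateField.adjoin k (s : Set K)) :=
    .of_injective (IntermediateField.val _) Subtype.val_injective
  have : Algebra.EssFiniteType k (IntermediateField.adjoin k (s : Set K)) :=
    IntermediateField.essFiniteType_iff.mpr ⟨s, rfl⟩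
  exact .of_isGeometricallyReduced_of_essFiniteType _ _

/-! ### Analytic independence of regular parameters. -/

theorem MvPolynomial.IsHomogeneous.eval₂_mul_right {σ R S : Type*} [CommSemiring R]
    [CommSemiring S] {F : MvPolynomial σ R} {d : ℕ} (hF : F.IsHomogeneous d) (f : R →+* S)
    (g : σ → S) (w : S) :
    MvPolynomial.eval₂ f (fun i ↦ g i * w) F = w ^ d * MvPolynomial.eval₂ f g F := by
  rw [MvPolynomial.eval₂_eq, MvPolynomial.eval₂_eq, Finset.mul_sum]
  refine Finset.sum_congr rfl fun m hm ↦ ?_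
  have hd : ∑ i ∈ m.support, m i = d := by
    have := hF (mem_support_iff.mp hm)
    rw [Pi.one_def, ← Finsupp.degree_eq_weight_one] at this
    exact this
  simp only [mul_pow, Finset.prod_mul_distrib, Finset.prod_pow_eq_pow_sum, hd]
  ring

open MvPolynomial IsLocalRing in
/-- A generic homogeneous relation between generators of the maximal ideal bounds the height of
that ideal. -/
theorem IsLocalRing.height_maximalIdeal_le_of_isUnit_eval₂ {R S : Type*} [CommRing R] [CommRing S]
    [IsLocalRing S] [IsNoetherianRing S] {I : Ideal R} {m : ℕ} {t : Fin (m + 1) → R}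
    (ht : Ideal.span (Set.range t) = I) {f : R →+* S} (hI : I.map f = maximalIdeal S)
    {g : Fin (m + 1) → S} (hg : IsUnit (g 0)) {F : MvPolynomial (Fin (m + 1)) R} {d : ℕ}
    (hF : F.IsHomogeneous d) (hFu : IsUnit (eval₂ f g F)) (h : eval t F ∈ I ^ (d + 1)) :
    (maximalIdeal S).height ≤ m := by
  obtain ⟨v, hv⟩ := hg
  have htm (i) : f (t i) ∈ maximalIdeal S := by
    rw [← hI, ← ht]
    exact Ideal.mem_map_of_mem _ (Ideal.subset_span ⟨i, rfl⟩)
  -- Modulo the `m` elements generating `U`, every `t i` becomes `g i * w`, so the maximal ideal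
  -- becomes principal and `F(t)` becomes `w ^ d * F(g)`.
  let w : S := f (t 0) * ↑v⁻¹
  have hw : w ∈ maximalIdeal S := Ideal.mul_mem_right _ _ (htm 0)
  have hw0 : f (t 0) = g 0 * w := by
    simp only [w]; rw [← hv, mul_left_comm, Units.mul_inv, mul_one]
  let s : Set S := Set.range fun i : Fin m ↦ f (t i.succ) - g i.succ * w
  let U : Ideal S := Ideal.span s
  let π := Ideal.Quotient.mk U
  have hπ (i) : π (f (t i)) = π (g i) * π w := by
    rw [← map_mul, ← sub_eq_zero, ← map_sub, Ideal.Quotient.eq_zero_iff_mem]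
    refine Fin.cases ?_ (fun j ↦ ?_) i
    · rw [hw0, sub_self]; exact U.zero_mem
    · exact Ideal.subset_span ⟨j, rfl⟩
  have hmap : I.map (π.comp f) ≤ Ideal.span {π w} := by
    rw [← ht, Ideal.map_span, Ideal.span_le]
    rintro _ ⟨_, ⟨i, rfl⟩, rfl⟩
    rw [RingHom.comp_apply, hπ]
    exact Ideal.mul_mem_left _ _ (Ideal.mem_span_singleton_self _)
  have h1 : π (f (eval t F)) = π w ^ d * π (eval₂ f g F) := by
    rw [← eval₂_id, ← RingHom.comp_apply π f, eval₂_comp_left, eval₂_comp_left, RingHomCompTriple.comp_eq,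
      ← hF.eval₂_mul_right]
    congr 1
    funext i
    exact hπ i
  have h2 : π (f (eval t F)) ∈ Ideal.span {π w ^ (d + 1)} := by
    rw [← Ideal.span_singleton_pow]
    have := Ideal.mem_map_of_mem (π.comp f) h
    rw [Ideal.map_pow] at this
    exact Ideal.pow_right_mono hmap _ this
  obtain ⟨r', hr'⟩ := Ideal.mem_span_singleton'.mp h2
  obtain ⟨r, rfl⟩ := Ideal.Quotient.mk_surjective r'
  have h3 : w ^ d * (eval₂ f g F - r * w) ∈ U := by
    rw [← Ideal.Quotient.eq_zero_iff_mem]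
    change π _ = 0
    rw [map_mul, map_sub, map_mul, mul_sub, map_pow, ← h1, ← hr']
    change π r * _ - _ = 0
    ring
  have hu : IsUnit (eval₂ f g F - r * w) := by
    by_contra hnu
    have := Ideal.add_mem _ ((mem_maximalIdeal _).mpr hnu) (Ideal.mul_mem_left _ r hw)
    rw [sub_add_cancel] at this
    exact (mem_maximalIdeal _).mp this hFu
  have hwU : w ^ d ∈ U := (Ideal.mul_unit_mem_iff_mem U hu).mp h3
  -- Since `w` is nilpotent modulo `U`, so is the maximal ideal; Krull's height theorem then applies
  -- to the `m` generators of `U`.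
  have hmin : maximalIdeal S ∈ U.minimalPrimes := by
    refine ⟨⟨inferInstance, ?_⟩, fun Q ⟨hQ, hUQ⟩ _ ↦ ?_⟩
    · rw [Ideal.span_le]
      rintro _ ⟨i, rfl⟩
      exact Ideal.sub_mem _ (htm _) (Ideal.mul_mem_left _ _ hw)
    · have hwQ : w ∈ Q := hQ.mem_of_pow_mem _ (hUQ hwU)
      rw [← hI, ← ht, Ideal.map_span, Ideal.span_le]
      rintro _ ⟨_, ⟨i, rfl⟩, rfl⟩
      have : π (f (t i)) ∈ Ideal.map π Q := by
        rw [hπ]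
        exact Ideal.mul_mem_left _ _ (Ideal.mem_map_of_mem _ hwQ)
      rwa [Ideal.mem_quotient_iff_mem hUQ] at this
  have hfin : s.Finite := Set.finite_range _
  refine (Ideal.height_le_card_of_mem_minimalPrimes_span hfin hmin).trans ?_
  have : s.ncard ≤ m := by
    simpa [s, Set.image_univ] using Set.ncard_image_le (s := Set.univ) Set.finite_univ
      (f := fun i : Fin m ↦ f (t i.succ) - g i.succ * w)
  exact_mod_cast this

open MvPolynomial IsLocalRing in
/-- A minimal system of generators of the maximal ideal of a regular local ring is analytically
independent. -/
theorem IsLocalRing.coeff_mem_maximalIdeal_of_isHomogeneous {R : Type*} [CommRing R]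
    [IsLocalRing R] [IsNoetherianRing R] {n : ℕ} (hdim : n ≤ ringKrullDim R) {t : Fin n → R}
    (ht : Ideal.span (Set.range t) = maximalIdeal R) {F : MvPolynomial (Fin n) R} {d : ℕ}
    (hF : F.IsHomogeneous d) (h : eval t F ∈ maximalIdeal R ^ (d + 1)) (β : Fin n →₀ ℕ) :
    F.coeff β ∈ maximalIdeal R := by
  obtain _ | m := n
  · have h1 : eval t F = F.coeff 0 := by
      conv_lhs => rw [eq_C_of_isEmpty F]
      simp
    rw [Subsingleton.elim β 0, ← h1]
    exact Ideal.pow_le_self (by simp) h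
  by_contra hβ
  -- Localizing `R[X]` at the extension of the maximal ideal makes the variables, and `F` if some
  -- coefficient is a unit, invertible. The localization is flat over `R`, so by going down the
  -- height of the maximal ideal of `R` would be at most `m`.
  let q : Ideal (MvPolynomial (Fin (m + 1)) R) := (maximalIdeal R).map C
  have hqk : q = RingHom.ker (MvPolynomial.map (σ := Fin (m + 1)) (residue R)) := by
    rw [MvPolynomial.ker_map, IsLocalRing.ker_residue (R := R)]
  have hq : q.IsPrime := hqk ▸ RingHom.ker_isPrime _
  have hmem (G : MvPolynomial (Fin (m + 1)) R) : G ∈ q ↔ ∀ i, G.coeff i ∈ maximalIdeal R :=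
    mem_map_C_iff
  have hFq : F ∉ q := fun h ↦ hβ ((hmem F).mp h β)
  have hXq : (X 0 : MvPolynomial (Fin (m + 1)) R) ∉ q := fun h ↦ by
    have := (hmem _).mp h (Finsupp.single 0 1)
    simp at this
  let a := algebraMap (MvPolynomial (Fin (m + 1)) R) (Localization.AtPrime q)
  have hover : (maximalIdeal (Localization.AtPrime q)).comap (a.comp C) = maximalIdeal R := by
    ext r
    rw [Ideal.mem_comap, RingHom.comp_apply, IsLocalization.AtPrime.to_map_mem_maximal_iff _ q,
      hmem]
    refine ⟨fun h ↦ by simpa using h 0, fun h i ↦ ?_⟩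
    rw [coeff_C]
    split_ifs
    exacts [h, zero_mem _]
  have hIm : (maximalIdeal R).map (a.comp C) = maximalIdeal (Localization.AtPrime q) := by
    rw [← Ideal.map_map]
    exact Localization.AtPrime.map_eq_maximalIdeal
  have hle := height_maximalIdeal_le_of_isUnit_eval₂ ht hIm (g := fun i ↦ a (X i))
    ((IsLocalization.AtPrime.isUnit_to_map_iff _ q _).mpr hXq) hF (by
      have : eval₂ (a.comp C) (fun i ↦ a (X i)) F = a F := by
        conv_rhs => rw [← eval₂_eta F, eval₂_comp_left]
        rfl
      rw [this]
      exact (IsLocalization.AtPrime.isUnit_to_map_iff _ q F).mpr hFq) h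
  have : Module.Flat R (Localization.AtPrime q) :=
    Module.Flat.trans R (MvPolynomial (Fin (m + 1)) R) _
  have : (maximalIdeal (Localization.AtPrime q)).LiesOver (maximalIdeal R) := ⟨hover.symm⟩
  have hge := Ideal.height_eq_height_add_of_liesOver_of_hasGoingDown (maximalIdeal R)
    (maximalIdeal (Localization.AtPrime q))
  have hge' : (maximalIdeal R).height ≤ m := le_trans (hge ▸ le_self_add) hle
  rw [← maximalIdeal_height_eq_ringKrullDim] at hdim
  have := hdim.trans (WithBot.coe_le_coe.mpr hge')
  have h4 : (((m + 1 : ℕ) : ℕ∞) : WithBot ℕ∞) ≤ ((m : ℕ∞) : WithBot ℕ∞) := this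
  rw [WithBot.coe_le_coe, Nat.cast_le] at h4
  omega

/-! ### Flatness and infinitesimal lifting. -/

/-- An explicit form of `Tor_1(A/m, T) = 0`. Write `x = ∑ a_i c_i` with `a_i ∈ m`. By flatness the
relation `∑ a_i φ(c_i) = 0` is trivial; subtracting a lift of its trivialization moves each `c_i`
into the kernel without changing `x`. -/
theorem Module.Flat.mem_map_mul_ker {A S T : Type*} [CommRing A] [CommRing S] [CommRing T]
    [Algebra A S] [Algebra A T] [Module.Flat A T] {φ : S →ₐ[A] T} (hφ : Function.Surjective φ)
    {m : Ideal A} {x : S} (hx : x ∈ m.map (algebraMap A S)) (hφx : φ x = 0) :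
    x ∈ m.map (algebraMap A S) * RingHom.ker φ := by
  rw [Ideal.map, Ideal.span, Submodule.mem_span_image_iff_exists_fun] at hx
  obtain ⟨t, htm, c, hc⟩ := hx
  have hrel : ∑ i : t, (i : A) • φ (c i) = 0 := by
    rw [← hφx, ← hc, map_sum]
    refine Finset.sum_congr rfl fun i _ ↦ ?_
    rw [smul_eq_mul, mul_comm, ← Algebra.smul_def, map_smul]
  obtain ⟨k, a, y, hy, ha⟩ :=
    Module.Flat.isTrivialRelation_of_sum_smul_eq_zero (f := fun i : t ↦ (i : A))
      (x := fun i ↦ φ (c i)) hrel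
  choose z hz using fun j ↦ hφ (y j)
  have hxe : x = ∑ i : t, algebraMap A S i * (c i - ∑ j, a i j • z j) := by
    simp only [mul_sub, Finset.sum_sub_distrib, ← hc, smul_eq_mul, Finset.mul_sum]
    rw [Finset.sum_comm (s := Finset.univ) (t := Finset.univ) (f := fun i j ↦ _ * (a i j • z j))]
    have : ∀ j, ∑ i : t, algebraMap A S i * (a i j • z j) = 0 := fun j ↦ by
      simp only [Algebra.smul_def, ← mul_assoc, ← map_mul, ← Finset.sum_mul, ← map_sum]
      rw [ha j, map_zero, zero_mul]
    simp only [this, Finset.sum_const_zero, sub_zero]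
    exact Finset.sum_congr rfl fun i _ ↦ mul_comm _ _
  rw [hxe]
  refine Ideal.sum_mem _ fun i _ ↦ Ideal.mul_mem_mul (Ideal.mem_map_of_mem _ (htm i.2)) ?_
  rw [RingHom.mem_ker, map_sub, map_sum, sub_eq_zero]
  refine (hy i).trans ?_
  exact Finset.sum_congr rfl fun j _ ↦ by rw [map_smul, hz]

/-- A square-zero extension of a flat algebra by a module killed by `m` meets `mE` trivially. -/
theorem Module.Flat.eq_zero_of_mem_map {A B E : Type*} [CommRing A] [CommRing B] [CommRing E]
    [Algebra A B] [Algebra A E] [Module.Flat A B] {m : Ideal A} {p : E →ₐ[A] B}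
    (hp : Function.Surjective p) (hm : ∀ a ∈ m, ∀ e, p e = 0 → a • e = 0) {x : E}
    (hx : x ∈ m.map (algebraMap A E)) (hpx : p x = 0) : x = 0 := by
  have h : m.map (algebraMap A E) ≤ Submodule.annihilator (RingHom.ker p) := by
    rw [Ideal.map_le_iff_le_comap]
    intro a ha
    rw [Ideal.mem_comap, Submodule.mem_annihilator]
    intro e he
    rw [smul_eq_mul, ← Algebra.smul_def]
    exact hm a ha e he
  have := Ideal.mul_mono_left h (mem_map_mul_ker hp hx hpx)
  rwa [← smul_eq_mul, Submodule.annihilator_smul] at this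

/-- Infinitesimal lifting for a flat algebra that is formally smooth modulo `m`, in terms of
sections of square-zero extensions. -/
theorem Module.Flat.exists_section_of_formallySmooth_quotient {A B E : Type*} [CommRing A]
    [CommRing B] [CommRing E] [Algebra A B] [Algebra A E] [Module.Flat A B] {m : Ideal A}
    [Algebra.FormallySmooth (A ⧸ m) (B ⧸ m.map (algebraMap A B))] {p : E →ₐ[A] B}
    (hp : Function.Surjective p) (hsq : ∀ x y, p x = 0 → p y = 0 → x * y = 0)
    (hm : ∀ a ∈ m, ∀ e, p e = 0 → a • e = 0) : ∃ s : B →ₐ[A] E, p.comp s = AlgHom.id A B := by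
  let I := m.map (algebraMap A E)
  have hI : I.map (p : E →+* B) = m.map (algebraMap A B) := by
    rw [Ideal.map_map, AlgHom.comp_algebraMap]
  let q : (E ⧸ I) →ₐ[A ⧸ m] (B ⧸ m.map (algebraMap A B)) :=
    { Ideal.quotientMap (m.map (algebraMap A B)) (p : E →+* B) (by
        rw [← Ideal.map_le_iff_le_comap]; exact hI.le) with
      commutes' := fun a ↦ by
        obtain ⟨a, rfl⟩ := Ideal.Quotient.mk_surjective a
        change Ideal.Quotient.mk _ (p (algebraMap A E a)) = Ideal.Quotient.mk _ (algebraMap A B a)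
        rw [AlgHom.commutes] }
  have hqmk (e : E) : q (Ideal.Quotient.mk _ e) = Ideal.Quotient.mk _ (p e) := rfl
  have hqs : Function.Surjective q := fun b ↦ by
    obtain ⟨b, rfl⟩ := Ideal.Quotient.mk_surjective b
    obtain ⟨e, rfl⟩ := hp b
    exact ⟨Ideal.Quotient.mk _ e, rfl⟩
  have hqker (z : E ⧸ I) (hz : q z = 0) : ∃ e, p e = 0 ∧ Ideal.Quotient.mk I e = z := by
    obtain ⟨e, rfl⟩ := Ideal.Quotient.mk_surjective z
    rw [hqmk, Ideal.Quotient.eq_zero_iff_mem, ← hI, Ideal.mem_map_iff_of_surjective (p : E →+* B) hp] at hz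
    obtain ⟨e', he', h⟩ := hz
    refine ⟨e - e', by rw [map_sub, sub_eq_zero]; exact h.symm, ?_⟩
    rw [map_sub, Ideal.Quotient.eq_zero_iff_mem.mpr he', sub_zero]
  have hnil : IsNilpotent (RingHom.ker q) := by
    refine ⟨2, ?_⟩
    rw [pow_two, Ideal.zero_eq_bot, eq_bot_iff, Ideal.mul_le]
    intro x hx y hy
    obtain ⟨x, hx', rfl⟩ := hqker x hx
    obtain ⟨y, hy', rfl⟩ := hqker y hy
    rw [← map_mul, hsq x y hx' hy', map_zero]
    exact zero_mem _
  let σ := Algebra.FormallySmooth.liftOfSurjective (AlgHom.id (A ⧸ m) _) q hqs hnil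
  have hσ (x) : q (σ x) = x := Algebra.FormallySmooth.liftOfSurjective_apply _ _ hqs hnil x
  -- `F` is the preimage in `E` of the image of the section `σ`. On `F` the map `p` is injective
  -- because `ker p` meets `mE` trivially, so its inverse is the desired section.
  let F : Subalgebra A E := AlgHom.equalizer (Ideal.Quotient.mkₐ A I)
    (((σ.restrictScalars A).comp (Ideal.Quotient.mkₐ A _)).comp p)
  have hF (e : E) : e ∈ F ↔ Ideal.Quotient.mk I e = σ (Ideal.Quotient.mk _ (p e)) := Iff.rfl
  have hr : Function.Bijective (p.comp F.val) := by
    constructor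
    · rw [injective_iff_map_eq_zero]
      intro e he
      have h1 : p e.1 = 0 := he
      refine Subtype.ext (Module.Flat.eq_zero_of_mem_map hp hm ?_ h1)
      have := (hF _).mp e.2
      rwa [h1, map_zero, map_zero, Ideal.Quotient.eq_zero_iff_mem] at this
    · intro b
      obtain ⟨e, rfl⟩ := hp b
      obtain ⟨e', he', h⟩ := hqker (Ideal.Quotient.mk I e - σ (Ideal.Quotient.mk _ (p e))) (by
        rw [map_sub, hσ, hqmk, sub_self])
      refine ⟨⟨e - e', (hF _).mpr ?_⟩, ?_⟩
      · rw [map_sub, h, map_sub, he', sub_zero, sub_sub_cancel]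
      · change p (e - e') = p e
        rw [map_sub, he', sub_zero]
  let s := AlgEquiv.ofBijective _ hr
  exact ⟨F.val.comp s.symm, AlgHom.ext fun b ↦ s.apply_symm_apply b⟩

/-- Infinitesimal lifting for a flat algebra that is formally smooth modulo `m`. -/
theorem Module.Flat.exists_lift_of_formallySmooth_quotient {A B C D : Type*} [CommRing A]
    [CommRing B] [CommRing C] [CommRing D] [Algebra A B] [Algebra A C] [Algebra A D]
    [Module.Flat A B] {m : Ideal A} [Algebra.FormallySmooth (A ⧸ m) (B ⧸ m.map (algebraMap A B))]
    {g : C →ₐ[A] D} (hg : Function.Surjective g) (hsq : ∀ x y, g x = 0 → g y = 0 → x * y = 0)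
    (hm : ∀ a ∈ m, ∀ c, g c = 0 → a • c = 0) (φ : B →ₐ[A] D) :
    ∃ ψ : B →ₐ[A] C, g.comp ψ = φ := by
  -- Lifts of `φ` correspond to sections of the fibre product `B ×_D C → B`, whose kernel is that of
  -- `g`.
  let E : Subalgebra A (B × C) :=
    AlgHom.equalizer (φ.comp (AlgHom.fst A B C)) (g.comp (AlgHom.snd A B C))
  have hE (e : E) : φ e.1.1 = g e.1.2 := e.2
  let p : E →ₐ[A] B := (AlgHom.fst A B C).comp E.val
  let p₂ : E →ₐ[A] C := (AlgHom.snd A B C).comp E.val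
  have hp : Function.Surjective p := fun b ↦ by
    obtain ⟨c, hc⟩ := hg (φ b)
    exact ⟨⟨(b, c), hc.symm⟩, rfl⟩
  have hker (e : E) (he : p e = 0) : g e.1.2 = 0 := by
    rw [← hE, show e.1.1 = 0 from he, map_zero]
  have hext (e : E) (h₁ : p e = 0) (h₂ : p₂ e = 0) : e = 0 := Subtype.ext (Prod.ext h₁ h₂)
  obtain ⟨s, hs⟩ := Module.Flat.exists_section_of_formallySmooth_quotient (m := m) hp
    (fun x y hx hy ↦ hext _ (by rw [map_mul, hx, zero_mul])
      (by rw [map_mul]; exact hsq _ _ (hker x hx) (hker y hy)))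
    (fun a ha e he ↦ hext _ (by rw [map_smul, he, smul_zero])
      (by rw [map_smul]; exact hm a ha _ (hker e he)))
  refine ⟨p₂.comp s, AlgHom.ext fun b ↦ ?_⟩
  change g (s b).1.2 = φ b
  rw [← hE]
  exact congrArg φ (DFunLike.congr_fun hs b)

/-- A flat algebra that is formally smooth modulo `m` lifts to adic completions. -/
theorem Module.Flat.exists_lift_adicCompletion {A B C : Type*} [CommRing A]
    [CommRing B] [CommRing C] [Algebra A B] [Algebra A C]
    [Module.Flat A B] {m : Ideal A} [Algebra.FormallySmooth (A ⧸ m) (B ⧸ m.map (algebraMap A B))]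
    {I : Ideal C} (hm : m.map (algebraMap A C) ≤ I) (φ : B →ₐ[A] C ⧸ I) :
    ∃ ψ : B →ₐ[A] AdicCompletion I C, ∀ b, AdicCompletion.evalOneₐ I (ψ b) = φ b := by
  -- Exponents start at 1: `I^(i+1)/I^(i+2)` has square zero because `2(i+1) ≥ i+2`, which fails for
  -- `I^0/I^1`.
  have hstep (i : ℕ) (f : B →ₐ[A] C ⧸ I ^ (i + 1)) : ∃ f' : B →ₐ[A] C ⧸ I ^ (i + 1 + 1),
      (Ideal.Quotient.factorₐ A (Ideal.pow_le_pow_right (Nat.le_succ (i + 1)))).comp f' = f := by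
    have hker (x : C ⧸ I ^ (i + 1 + 1))
        (hx : Ideal.Quotient.factorₐ A (Ideal.pow_le_pow_right (Nat.le_succ (i + 1))) x = 0) :
        ∃ y ∈ I ^ (i + 1), Ideal.Quotient.mk _ y = x := by
      obtain ⟨y, rfl⟩ := Ideal.Quotient.mk_surjective x
      exact ⟨y, Ideal.Quotient.eq_zero_iff_mem.mp hx, rfl⟩
    refine Module.Flat.exists_lift_of_formallySmooth_quotient (m := m)
      (Ideal.Quotient.factor_surjective (Ideal.pow_le_pow_right (Nat.le_succ (i + 1)))) (fun x y hx hy ↦ ?_) (fun a ha c hc ↦ ?_) f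
    · obtain ⟨x, hx', rfl⟩ := hker x hx
      obtain ⟨y, hy', rfl⟩ := hker y hy
      rw [← map_mul, Ideal.Quotient.eq_zero_iff_mem]
      have := Ideal.mul_mem_mul hx' hy'
      rw [← pow_add] at this
      exact Ideal.pow_le_pow_right (by omega) this
    · obtain ⟨c, hc', rfl⟩ := hker c hc
      rw [Algebra.smul_def, IsScalarTower.algebraMap_apply A C, Ideal.Quotient.algebraMap_eq,
        ← map_mul, Ideal.Quotient.eq_zero_iff_mem, pow_succ']
      exact Ideal.mul_mem_mul (hm (Ideal.mem_map_of_mem _ ha)) hc'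
  choose next hnext using hstep
  let f : ∀ i, B →ₐ[A] C ⧸ I ^ (i + 1) := fun i ↦ Nat.rec
    ((Ideal.Quotient.factorₐ A (by simp)).comp φ) (fun i f ↦ next i f) i
  have hf (i : ℕ) (b : B) :
      Ideal.Quotient.factorₐ A (Ideal.pow_le_pow_right (Nat.le_succ (i + 1))) (f (i + 1) b)
        = f i b := DFunLike.congr_fun (hnext i (f i)) b
  have hf' {i j : ℕ} (h : i ≤ j) (b : B) : Ideal.Quotient.factorₐ A
      (Ideal.pow_le_pow_right (Nat.succ_le_succ h)) (f j b) = f i b := by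
    induction j, h using Nat.le_induction with
    | base => simp
    | succ j h ih =>
      rw [← ih, ← hf j b]
      obtain ⟨y, hy⟩ := Ideal.Quotient.mk_surjective (f (j + 1) b)
      rw [← hy]
      rfl
  refine ⟨AdicCompletion.liftAlgHom I (fun i ↦ (Ideal.Quotient.factorₐ A
    (Ideal.pow_le_pow_right (Nat.le_succ i))).comp (f i)) (fun {i j} h ↦ ?_), fun b ↦ ?_⟩
  · ext b
    obtain ⟨y, hy⟩ := Ideal.Quotient.mk_surjective (f j b)
    simp only [AlgHom.comp_apply]
    rw [← hf' h b, ← hy]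
    rfl
  · rw [AdicCompletion.evalOneₐ_liftAlgHom]
    have h0 := hf 0 b
    rw [AlgHom.comp_apply]
    refine (congrArg _ h0).trans ?_
    obtain ⟨y, hy⟩ := Ideal.Quotient.mk_surjective (φ b)
    change Ideal.Quotient.factorₐ A (pow_one I).le (Ideal.Quotient.factorₐ A (pow_one I).ge (φ b)) = _
    rw [← hy]
    rfl

/-! ### Continuity of maps between adic completions. -/

namespace AdicCompletion

variable {A B R : Type*} [CommRing A] [CommRing B] [CommRing R] [Algebra A B] [Algebra A R]
  {J : Ideal B} {I : Ideal R} {ψ : B →ₐ[A] AdicCompletion I R}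
  (hψ : ∀ b ∈ J, evalOneₐ I (ψ b) = 0)

theorem factor_evalₐ {i j : ℕ} (h : i ≤ j) (x : AdicCompletion I R) :
    Ideal.Quotient.factor (Ideal.pow_le_pow_right h) (evalₐ I j x) = evalₐ I i x := by
  induction x using AdicCompletion.induction_on with
  | _ x =>
    rw [evalₐ_mk, evalₐ_mk, Ideal.Quotient.factor_mk]
    exact Ideal.mk_eq_mk I h x

theorem evalₐ_eq_zero_of_mem_pow {S : Type*} [CommRing S] {J : Ideal S}
    (f : S →+* AdicCompletion I R) (hf : ∀ b ∈ J, evalOneₐ I (f b) = 0) (i : ℕ) {b : S}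
    (hb : b ∈ J ^ i) : evalₐ I i (f b) = 0 := by
  obtain _ | i := i
  · have : Subsingleton (R ⧸ I ^ 0) := Ideal.Quotient.subsingleton_iff.mpr (by simp)
    exact Subsingleton.elim _ _
  have h1 : J.map ((evalₐ I (i + 1) : AdicCompletion I R →+* R ⧸ I ^ (i + 1)).comp f) ≤
      I.map (Ideal.Quotient.mk (I ^ (i + 1))) := by
    rw [Ideal.map_le_iff_le_comap]
    intro b hb
    obtain ⟨r, hr⟩ := Ideal.Quotient.mk_surjective (evalₐ I (i + 1) (f b))
    have h2 := factor_evalₐ (Nat.le_add_left 1 i) (f b)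
    have h3 := hf b hb
    rw [← factorₐ_evalₐ_one, ← h2, ← hr] at h3
    have h4 : r ∈ I := Ideal.Quotient.eq_zero_iff_mem.mp h3
    rw [Ideal.mem_comap, RingHom.comp_apply]
    exact hr ▸ Ideal.mem_map_of_mem _ h4
  have h2 := Ideal.mem_map_of_mem ((evalₐ I (i + 1) : AdicCompletion I R →+* R ⧸ I ^ (i + 1)).comp f) hb
  rw [Ideal.map_pow] at h2
  have h3 := Ideal.pow_right_mono h1 _ h2
  rw [← Ideal.map_pow, Ideal.map_quotient_self] at h3
  exact h3

/-- The map from `AdicCompletion J B` to `R ⧸ I ^ i` induced by `ψ`. -/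
noncomputable def mapQuotient (i : ℕ) : AdicCompletion J B →ₐ[A] R ⧸ I ^ i :=
  (Ideal.Quotient.liftₐ (J ^ i) (((evalₐ I i).restrictScalars A).comp ψ)
    (fun _ hb ↦ evalₐ_eq_zero_of_mem_pow (J := J) ψ.toRingHom hψ i hb)).comp
    ((evalₐ J i).restrictScalars A)

theorem mapQuotient_of (i : ℕ) (b : B) :
    mapQuotient hψ i (of J B b) = evalₐ I i (ψ b) := by
  simp only [mapQuotient, AlgHom.comp_apply, AlgHom.restrictScalars_apply, evalₐ_of]
  rfl

theorem mapQuotient_eq_zero {i : ℕ} {x : AdicCompletion J B} (hx : evalₐ J i x = 0) :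
    mapQuotient hψ i x = 0 := by
  simp [mapQuotient, hx]

theorem factor_mapQuotient {i j : ℕ} (h : i ≤ j) (x : AdicCompletion J B) :
    Ideal.Quotient.factor (Ideal.pow_le_pow_right h) (mapQuotient hψ j x) =
      mapQuotient hψ i x := by
  obtain ⟨b, hb⟩ := Ideal.Quotient.mk_surjective (evalₐ J j x)
  have hb' : Ideal.Quotient.mk (J ^ i) b = evalₐ J i x := by
    rw [← factor_evalₐ h, ← hb]; rfl
  simp only [mapQuotient, AlgHom.comp_apply, AlgHom.restrictScalars_apply, ← hb, ← hb']
  exact factor_evalₐ h (ψ b)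

theorem mapQuotient_mem {i k : ℕ} {x : AdicCompletion J B} (hx : evalₐ J k x = 0) (h : k ≤ i) :
    mapQuotient hψ i x ∈ (I ^ k).map (Ideal.Quotient.mk (I ^ i)) := by
  obtain ⟨r, hr⟩ := Ideal.Quotient.mk_surjective (mapQuotient hψ i x)
  have := factor_mapQuotient hψ h x
  rw [mapQuotient_eq_zero hψ hx, ← hr, Ideal.Quotient.factor_mk,
    Ideal.Quotient.eq_zero_iff_mem] at this
  rw [← hr]
  exact Ideal.mem_map_of_mem _ this

end AdicCompletion

open AdicCompletion

/-! ### Evaluation of power series in an adic completion. -/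

namespace MvPowerSeries

variable {A B R : Type*} [CommRing A] [CommRing B] [CommRing R] [Algebra A B] [Algebra A R]
  {J : Ideal B} {I : Ideal R} {ψ : B →ₐ[A] AdicCompletion I R}
  (hψ : ∀ b ∈ J, evalOneₐ I (ψ b) = 0) {σ : Type*}

/-- Evaluation of polynomials over `AdicCompletion J B` at `t`, modulo `I ^ i`. -/
noncomputable def evalQuotientPoly (t : σ → R) (i : ℕ) :
    MvPolynomial σ (AdicCompletion J B) →+* R ⧸ I ^ i :=
  MvPolynomial.eval₂Hom (mapQuotient hψ i : AdicCompletion J B →+* R ⧸ I ^ i)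
    (fun s ↦ Ideal.Quotient.mk _ (t s))

theorem evalQuotientPoly_eq_zero {t : σ → R} (ht : ∀ i, t i ∈ I) (i : ℕ) {p : MvPolynomial σ (AdicCompletion J B)}
    (hp : p ∈ MvPolynomial.idealOfVars σ (AdicCompletion J B) ^ i) :
    evalQuotientPoly hψ t i p = 0 := by
  have h1 : (MvPolynomial.idealOfVars σ (AdicCompletion J B)).map (evalQuotientPoly hψ t i) ≤
      I.map (Ideal.Quotient.mk (I ^ i)) := by
    rw [Ideal.map_span, Ideal.span_le]
    rintro _ ⟨_, ⟨s, rfl⟩, rfl⟩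
    rw [evalQuotientPoly, MvPolynomial.eval₂Hom_X']
    exact Ideal.mem_map_of_mem _ (ht s)
  have h2 := Ideal.mem_map_of_mem (evalQuotientPoly hψ t i) hp
  rw [Ideal.map_pow] at h2
  have h3 := Ideal.pow_right_mono h1 i h2
  rwa [← Ideal.map_pow, Ideal.map_quotient_self] at h3

theorem factor_evalQuotientPoly {i j : ℕ} (h : i ≤ j)
    (p : MvPolynomial σ (AdicCompletion J B)) :
    Ideal.Quotient.factor (Ideal.pow_le_pow_right h) (evalQuotientPoly hψ t j p) =
      evalQuotientPoly hψ t i p := by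
  rw [← RingHom.comp_apply]
  congr 1
  ext x
  · simp only [evalQuotientPoly, RingHom.comp_apply, MvPolynomial.eval₂Hom_C]
    exact factor_mapQuotient hψ h x
  · simp [evalQuotientPoly]

variable [Finite σ] {t : σ → R} (ht : ∀ i, t i ∈ I)

/-- Evaluation of power series over `AdicCompletion J B` at `t`, modulo `I ^ i`, as a ring
homomorphism. -/
noncomputable def evalQuotientRingHom (i : ℕ) :
    MvPowerSeries σ (AdicCompletion J B) →+* R ⧸ I ^ i :=
  (Ideal.Quotient.lift _ (evalQuotientPoly hψ t i)
      (fun _ h ↦ evalQuotientPoly_eq_zero hψ ht i h)).comp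
      (truncTotalAlgHom σ (AdicCompletion J B) i).toRingHom

theorem evalQuotientRingHom_apply (i : ℕ) (f : MvPowerSeries σ (AdicCompletion J B)) :
    evalQuotientRingHom hψ ht i f = evalQuotientPoly hψ t i (truncTotal i f) := rfl

theorem evalQuotientRingHom_coe (i : ℕ) (p : MvPolynomial σ (AdicCompletion J B)) :
    evalQuotientRingHom hψ ht i p = evalQuotientPoly hψ t i p := by
  have := (truncTotalAlgHom σ (AdicCompletion J B) i).commutes p
  exact congrArg (Ideal.Quotient.lift _ (evalQuotientPoly hψ t i)
      (fun _ h ↦ evalQuotientPoly_eq_zero hψ ht i h)) this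

theorem factor_evalQuotientRingHom {i j : ℕ} (h : i ≤ j) :
    (Ideal.Quotient.factorPow I h).comp (evalQuotientRingHom hψ ht j) =
      evalQuotientRingHom hψ ht i := by
  ext f
  rw [RingHom.comp_apply, evalQuotientRingHom_apply, evalQuotientRingHom_apply]
  refine (factor_evalQuotientPoly hψ h _).trans ?_
  rw [← sub_eq_zero, ← map_sub]
  exact evalQuotientPoly_eq_zero hψ ht i
    (truncTotal_sub_truncTotal_mem_pow_idealOfVars h le_rfl f)

/-- Evaluation of power series over `AdicCompletion J B` at `t`. -/
noncomputable def evalAdic :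
    MvPowerSeries σ (AdicCompletion J B) →ₐ[A] AdicCompletion I R :=
  { AdicCompletion.liftRingHom I (evalQuotientRingHom hψ ht)
      (factor_evalQuotientRingHom hψ ht) with
    commutes' := fun a ↦ AdicCompletion.ext_evalₐ fun i ↦ by
      refine (evalₐ_liftRingHom I _ (factor_evalQuotientRingHom hψ ht) i _).trans ?_
      have : algebraMap A (MvPowerSeries σ (AdicCompletion J B)) a =
        ((MvPolynomial.C (algebraMap A _ a) : MvPolynomial σ (AdicCompletion J B)) :
          MvPowerSeries σ (AdicCompletion J B)) := by
        rw [MvPolynomial.coe_C, MvPowerSeries.algebraMap_apply]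
      rw [this, evalQuotientRingHom_coe, evalQuotientPoly, MvPolynomial.eval₂Hom_C]
      refine ((mapQuotient hψ i).commutes a).trans ?_
      exact (((evalₐ I i).restrictScalars A).commutes a).symm }

theorem evalₐ_evalAdic (i : ℕ) (f : MvPowerSeries σ (AdicCompletion J B)) :
    evalₐ I i (evalAdic hψ ht f) = evalQuotientPoly hψ t i (truncTotal i f) :=
  evalₐ_liftRingHom I _ (factor_evalQuotientRingHom hψ ht) i _

end MvPowerSeries

/-! ### Surjectivity of evaluation. -/

/-- The coefficient condition describes the `i`-th power of the ideal `(J, X)`; truncated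
subtraction makes it vacuous in degrees at least `i`. -/
theorem MvPolynomial.coeff_mul_mem_pow_sub {σ B : Type*} [CommRing B] {J : Ideal B} {i j : ℕ}
    {p q : MvPolynomial σ B} (hp : ∀ β, p.coeff β ∈ J ^ (i - β.degree))
    (hq : ∀ β, q.coeff β ∈ J ^ (j - β.degree)) (β : σ →₀ ℕ) :
    (p * q).coeff β ∈ J ^ (i + j - β.degree) := by
  classical
  rw [MvPolynomial.coeff_mul]
  refine Ideal.sum_mem _ fun x hx ↦ ?_
  have h := Ideal.mul_mem_mul (hp x.1) (hq x.2)
  rw [← pow_add] at h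
  refine Ideal.pow_le_pow_right ?_ h
  rw [← Finset.HasAntidiagonal.mem_antidiagonal.mp hx, map_add]
  omega

namespace MvPowerSeries

theorem exists_forall_evalₐ_coeff_eq {σ B : Type*} [CommRing B] {J : Ideal B}
    {h : ℕ → MvPolynomial σ B} (hh : ∀ i β, (h (i + 1) - h i).coeff β ∈ J ^ (i - β.degree)) :
    ∃ f : MvPowerSeries σ (AdicCompletion J B), ∀ i β,
      evalₐ J (i - β.degree) (coeff β f) = Ideal.Quotient.mk _ ((h i).coeff β) := by
  -- At stage `i` the coefficient at `β` is known only modulo `J ^ (i - |β|)`; the shift by `|β|`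
  -- restores precision `k` at index `k`.
  let c (β : σ →₀ ℕ) : AdicCauchySequence J B :=
    AdicCauchySequence.mk J B (fun k ↦ (h (k + β.degree)).coeff β) fun k ↦ by
      rw [SModEq.comm, SModEq.sub_mem, smul_eq_mul, Ideal.mul_top, ← MvPolynomial.coeff_sub,
        add_right_comm]
      simpa using hh (k + β.degree) β
  refine ⟨fun β ↦ AdicCompletion.mk J B (c β), fun i β ↦ ?_⟩
  change evalₐ J (i - β.degree) (AdicCompletion.mk J B (c β)) = _
  rw [evalₐ_mk]
  obtain hi | hi := le_total β.degree i
  · change Ideal.Quotient.mk _ ((h (i - β.degree + β.degree)).coeff β) = _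
    rw [Nat.sub_add_cancel hi]
  · have : Subsingleton (B ⧸ J ^ (i - β.degree)) := Ideal.Quotient.subsingleton_iff.mpr (by
      rw [Nat.sub_eq_zero_of_le hi, pow_zero, Ideal.one_eq_top])
    exact Subsingleton.elim _ _

variable {A B R : Type*} [CommRing A] [CommRing B] [CommRing R] [Algebra A B] [Algebra A R]
  {J : Ideal B} {I : Ideal R} {ψ : B →ₐ[A] AdicCompletion I R}
  (hψ : ∀ b ∈ J, evalOneₐ I (ψ b) = 0) {σ : Type*} {t : σ → R}

theorem evalQuotientPoly_eq_zero_of_forall_coeff (ht : ∀ i, t i ∈ I) {i : ℕ}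
    {p : MvPolynomial σ (AdicCompletion J B)}
    (hp : ∀ β, evalₐ J (i - β.degree) (p.coeff β) = 0) : evalQuotientPoly hψ t i p = 0 := by
  rw [evalQuotientPoly, MvPolynomial.coe_eval₂Hom, MvPolynomial.eval₂_eq]
  refine Finset.sum_eq_zero fun β _ ↦ ?_
  have h1 := mapQuotient_mem hψ (hp β) (Nat.sub_le i β.degree)
  have h2 : ∏ s ∈ β.support, Ideal.Quotient.mk (I ^ i) (t s) ^ β s ∈
      (I ^ β.degree).map (Ideal.Quotient.mk (I ^ i)) := by
    rw [Ideal.map_pow, Finsupp.degree_apply, ← Finset.prod_pow_eq_pow_sum]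
    exact Ideal.prod_mem_prod fun s _ ↦ Ideal.pow_mem_pow (Ideal.mem_map_of_mem _ (ht s)) _
  have h3 := Ideal.mul_mem_mul h1 h2
  rw [← Ideal.map_mul, ← pow_add] at h3
  have h4 := Ideal.map_mono (f := Ideal.Quotient.mk (I ^ i))
    (Ideal.pow_le_pow_right (I := I) (show i ≤ i - β.degree + β.degree by omega)) h3
  rwa [Ideal.map_quotient_self] at h4

/-- Evaluation of polynomials over `B` at `t`, modulo `I ^ i`. -/
noncomputable def evalPoly (ψ : B →ₐ[A] AdicCompletion I R) (t : σ → R) (i : ℕ) :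
    MvPolynomial σ B →+* R ⧸ I ^ i :=
  MvPolynomial.eval₂Hom (((evalₐ I i).restrictScalars A).comp ψ : B →ₐ[A] R ⧸ I ^ i).toRingHom
    (fun s ↦ Ideal.Quotient.mk _ (t s))

theorem evalPoly_C (i : ℕ) (b : B) :
    evalPoly ψ t i (MvPolynomial.C b) = evalₐ I i (ψ b) :=
  MvPolynomial.eval₂_C ..

theorem evalPoly_X (i : ℕ) (s : σ) :
    evalPoly ψ t i (MvPolynomial.X s) = Ideal.Quotient.mk _ (t s) :=
  MvPolynomial.eval₂_X ..

theorem evalQuotientPoly_map (i : ℕ) (p : MvPolynomial σ B) :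
    evalQuotientPoly hψ t i (MvPolynomial.map (algebraMap B (AdicCompletion J B)) p) =
      evalPoly ψ t i p := by
  rw [← RingHom.comp_apply]
  congr 1
  ext x
  · simp only [evalQuotientPoly, RingHom.comp_apply, MvPolynomial.map_C, MvPolynomial.eval₂Hom_C,
      evalPoly_C]
    exact mapQuotient_of hψ i x
  · simp [evalQuotientPoly, evalPoly_X]

theorem factor_evalPoly {i j : ℕ} (h : i ≤ j) (p : MvPolynomial σ B) :
    Ideal.Quotient.factor (Ideal.pow_le_pow_right h) (evalPoly ψ t j p) = evalPoly ψ t i p := by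
  rw [← RingHom.comp_apply]
  congr 1
  ext x
  · simp only [RingHom.comp_apply, evalPoly_C]
    exact factor_evalₐ h (ψ x)
  · simp only [RingHom.comp_apply, evalPoly_X, Ideal.Quotient.factor_mk]

/-- The graded form of surjectivity: generators of `I` lift to constants from `m` and to variables,
both of order 1 in the `(J, X)`-filtration, and order 0 is surjectivity onto `R/I`. -/
theorem exists_evalPoly_eq {m : Ideal A} (hm : m.map (algebraMap A B) ≤ J)
    (hI : I = m.map (algebraMap A R) ⊔ Ideal.span (Set.range t))
    (hs : ∀ r, ∃ b, evalOneₐ I (ψ b) = Ideal.Quotient.mk I r) (i : ℕ) :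
    ∀ y ∈ I ^ i, ∃ g : MvPolynomial σ B, (∀ β, g.coeff β ∈ J ^ (i - β.degree)) ∧
      evalPoly ψ t (i + 1) g = Ideal.Quotient.mk _ y := by
  classical
  induction i with
  | zero =>
    intro y _
    obtain ⟨b, hb⟩ := hs y
    refine ⟨MvPolynomial.C b, by simp, ?_⟩
    rw [evalPoly_C]
    obtain ⟨r, hr⟩ := Ideal.Quotient.mk_surjective (evalₐ I (0 + 1) (ψ b))
    rw [← factorₐ_evalₐ_one] at hb
    change Ideal.Quotient.factor _ (evalₐ I (0 + 1) (ψ b)) = _ at hb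
    rw [← hr, Ideal.Quotient.factor_mk, Ideal.Quotient.mk_eq_mk_iff_sub_mem] at hb
    rw [← hr, Ideal.Quotient.mk_eq_mk_iff_sub_mem]
    simpa using hb
  | succ i ih =>
    let good (y : R) : Prop := ∃ g : MvPolynomial σ B, (∀ β, g.coeff β ∈ J ^ (i + 1 - β.degree)) ∧
      evalPoly ψ t (i + 1 + 1) g = Ideal.Quotient.mk _ y
    have hadd (x y : R) (hx : good x) (hy : good y) : good (x + y) := by
      obtain ⟨g, hg, hgx⟩ := hx
      obtain ⟨k, hk, hky⟩ := hy
      exact ⟨g + k, fun β ↦ by rw [MvPolynomial.coeff_add]; exact add_mem (hg β) (hk β),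
        by rw [map_add, hgx, hky, map_add]⟩
    have hmul (x : R) (hx : x ∈ I) (p : MvPolynomial σ B)
        (hp : ∀ β, p.coeff β ∈ J ^ (1 - β.degree))
        (hpx : evalPoly ψ t (i + 1 + 1) p = Ideal.Quotient.mk _ x) (z : R) (hz : z ∈ I ^ i) :
        good (x * z) := by
      obtain ⟨g, hg, hgz⟩ := ih z hz
      refine ⟨p * g, fun β ↦ ?_, ?_⟩
      · rw [add_comm]
        exact MvPolynomial.coeff_mul_mem_pow_sub hp hg β
      · obtain ⟨e, he⟩ := Ideal.Quotient.mk_surjective (evalPoly ψ t (i + 1 + 1) g)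
        rw [← factor_evalPoly (Nat.le_succ (i + 1)), ← he, Ideal.Quotient.factor_mk,
          Ideal.Quotient.mk_eq_mk_iff_sub_mem] at hgz
        rw [map_mul, hpx, ← he, ← map_mul, Ideal.Quotient.mk_eq_mk_iff_sub_mem, ← mul_sub,
          pow_succ' I (i + 1)]
        exact Ideal.mul_mem_mul hx hgz
    -- Quantifying over `z` lets scalars from `R` be absorbed into `z`, so only the generators of
    -- `I` need lifts.
    have hkey (x : R) (hx : x ∈ Ideal.span ((algebraMap A R '' m) ∪ Set.range t)) :
        ∀ z ∈ I ^ i, good (x * z) := by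
      induction hx using Submodule.span_induction with
      | mem x hx =>
        obtain ⟨a, ha, rfl⟩ | ⟨s, rfl⟩ := hx
        · refine hmul _ (hI ▸ Ideal.mem_sup_left (Ideal.mem_map_of_mem _ ha))
            (MvPolynomial.C (algebraMap A B a)) (fun β ↦ ?_) ?_
          · rw [MvPolynomial.coeff_C]
            split_ifs with h
            · subst h
              simpa using hm (Ideal.mem_map_of_mem _ ha)
            · exact zero_mem _
          · rw [evalPoly_C, AlgHom.commutes]
            exact ((evalₐ I (i + 1 + 1)).restrictScalars A).commutes a
        · refine hmul _ (hI ▸ Ideal.mem_sup_right (Ideal.subset_span ⟨s, rfl⟩))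
            (MvPolynomial.X s) (fun β ↦ ?_) (evalPoly_X _ _)
          rw [MvPolynomial.coeff_X]
          split_ifs with h
          · subst h
            simp
          · exact zero_mem _
      | zero => exact fun z _ ↦ ⟨0, by simp, by simp⟩
      | add x y _ _ hx hy =>
        intro z hz
        rw [add_mul]
        exact hadd _ _ (hx z hz) (hy z hz)
      | smul c x _ hx =>
        intro z hz
        rw [smul_eq_mul, mul_comm c, mul_assoc]
        exact hx _ (Ideal.mul_mem_left _ c hz)
    intro y hy
    rw [pow_succ'] at hy
    refine Submodule.mul_induction_on hy (fun x hx z hz ↦ hkey x ?_ z hz) hadd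
    rw [Ideal.span_union]
    exact hI.le hx

theorem evalAdic_surjective [Finite σ] (ht : ∀ i, t i ∈ I) {m : Ideal A}
    (hm : m.map (algebraMap A B) ≤ J)
    (hI : I = m.map (algebraMap A R) ⊔ Ideal.span (Set.range t))
    (hs : ∀ r, ∃ b, evalOneₐ I (ψ b) = Ideal.Quotient.mk I r) :
    Function.Surjective (evalAdic hψ ht) := by
  intro y
  -- The error at stage `i` lies in `I ^ i` and is cancelled modulo `I ^ (i + 1)` by a polynomial of
  -- order `i`, so the corrections converge.
  have hstep (i : ℕ) (h : {h : MvPolynomial σ B // evalPoly ψ t i h = evalₐ I i y}) :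
      ∃ h' : {h : MvPolynomial σ B // evalPoly ψ t (i + 1) h = evalₐ I (i + 1) y},
        ∀ β, (h'.1 - h.1).coeff β ∈ J ^ (i - β.degree) := by
    obtain ⟨r, hr⟩ := Ideal.Quotient.mk_surjective
      (evalₐ I (i + 1) y - evalPoly ψ t (i + 1) h.1)
    have hrI : r ∈ I ^ i := by
      rw [← Ideal.Quotient.eq_zero_iff_mem,
        ← Ideal.Quotient.factor_mk (Ideal.pow_le_pow_right (Nat.le_succ i)), hr, map_sub,
        factor_evalₐ (Nat.le_succ i), factor_evalPoly (Nat.le_succ i), h.2, sub_self]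
    obtain ⟨g, hg, hgr⟩ := exists_evalPoly_eq hm hI hs i r hrI
    refine ⟨⟨h.1 + g, by rw [map_add, hgr, hr, add_sub_cancel]⟩, fun β ↦ ?_⟩
    simpa using hg β
  choose next hnext using hstep
  have h0 : evalPoly ψ t 0 (0 : MvPolynomial σ B) = evalₐ I 0 y := by
    have : Subsingleton (R ⧸ I ^ 0) := Ideal.Quotient.subsingleton_iff.mpr (by simp)
    exact Subsingleton.elim _ _
  let h : ∀ i, {h : MvPolynomial σ B // evalPoly ψ t i h = evalₐ I i y} :=
    fun i ↦ Nat.rec ⟨0, h0⟩ (fun i h ↦ next i h) i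
  obtain ⟨f, hf⟩ := exists_forall_evalₐ_coeff_eq (h := fun i ↦ (h i).1) (J := J)
    (fun i ↦ hnext i (h i))
  refine ⟨f, ext_evalₐ fun i ↦ ?_⟩
  rw [evalₐ_evalAdic, ← (h i).2, ← evalQuotientPoly_map hψ, ← sub_eq_zero, ← map_sub]
  refine evalQuotientPoly_eq_zero_of_forall_coeff hψ ht fun β ↦ ?_
  rw [MvPolynomial.coeff_sub, MvPolynomial.coeff_map, map_sub, sub_eq_zero]
  obtain hi | hi := lt_or_ge β.degree i
  · rw [coeff_truncTotal _ hi, hf]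
    exact (evalₐ_of _ _ _).symm
  · have : Subsingleton (B ⧸ J ^ (i - β.degree)) := Ideal.Quotient.subsingleton_iff.mpr (by
      rw [Nat.sub_eq_zero_of_le hi, pow_zero, Ideal.one_eq_top])
    exact Subsingleton.elim _ _

end MvPowerSeries

/-! ### Injectivity of evaluation. -/

theorem Ideal.le_pow_of_le_mul {S : Type*} [CommRing S] {K N : Ideal S} (h : N ≤ K * N) (i : ℕ) :
    N ≤ K ^ i := by
  have : N ≤ K ^ i * N := by
    induction i with
    | zero => simp
    | succ i ih =>
      rw [pow_succ, mul_assoc]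
      exact ih.trans (Ideal.mul_mono_right h)
  exact this.trans Ideal.mul_le_left

namespace MvPowerSeries

/-- Finite generation matters: expansions of the infinitely many coefficients in fixed generators
assemble into finitely many power series. -/
theorem mem_map_of_forall_coeff_mem {σ A S : Type*} [CommRing A] [CommRing S] [Algebra A S]
    {m : Ideal A} (hm : m.FG) {f : MvPowerSeries σ S}
    (hf : ∀ β, coeff β f ∈ m.map (algebraMap A S)) :
    f ∈ m.map (algebraMap A (MvPowerSeries σ S)) := by
  obtain ⟨s, rfl⟩ := hm
  simp only [Ideal.map_span, Ideal.span, Submodule.mem_span_image_finset_iff_exists_fun] at hf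
  choose c hc using hf
  let g (a : s) : MvPowerSeries σ S := fun β ↦ c β a
  have : f = ∑ a : s, g a * algebraMap A (MvPowerSeries σ S) a.1 := by
    ext β
    rw [← hc, map_sum]
    refine Finset.sum_congr rfl fun a _ ↦ ?_
    rw [algebraMap_apply, coeff_mul_C]
    rfl
  rw [this]
  exact Ideal.sum_mem _ fun a _ ↦ Ideal.mul_mem_left _ _
    (Ideal.mem_map_of_mem _ (Ideal.subset_span a.2))

variable {A B R : Type*} [CommRing A] [CommRing B] [CommRing R] [Algebra A B] [Algebra A R]
  {J : Ideal B} {I : Ideal R} {ψ : B →ₐ[A] AdicCompletion I R}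
  (hψ : ∀ b ∈ J, evalOneₐ I (ψ b) = 0) {σ : Type*} [Finite σ] {t : σ → R} (ht : ∀ i, t i ∈ I)

/-- Induction on the degree `d`. Coefficients of lower degree lie in `mB̂` and die in `R/mR`, so
modulo `I ^ (d + 1)` only the degree `d` form of `f` contributes to its value 0, and analytic
independence applies to that form. -/
theorem evalₐ_coeff_eq_zero_of_evalAdic_eq_zero {m : Ideal A} (hmI : m.map (algebraMap A R) ≤ I)
    (hker : ∀ x : AdicCompletion J B, evalₐ J 1 x = 0 → x ∈ m.map (algebraMap A _))
    (hinj : ∀ x, mapQuotient hψ 1 x = 0 → evalₐ J 1 x = 0)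
    (hind : ∀ (d : ℕ) (F : MvPolynomial σ (R ⧸ m.map (algebraMap A R))), F.IsHomogeneous d →
      MvPolynomial.eval (fun s ↦ Ideal.Quotient.mk _ (t s)) F ∈
        (I.map (Ideal.Quotient.mk (m.map (algebraMap A R)))) ^ (d + 1) →
      ∀ β, F.coeff β ∈ I.map (Ideal.Quotient.mk (m.map (algebraMap A R))))
    {f : MvPowerSeries σ (AdicCompletion J B)} (hf : evalAdic hψ ht f = 0) (β : σ →₀ ℕ) :
    evalₐ J 1 (coeff β f) = 0 := by
  induction hd : β.degree using Nat.strong_induction_on generalizing β with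
  | _ d ih =>
  subst hd
  set d := β.degree
  set K := m.map (algebraMap A R)
  let I' := I.map (Ideal.Quotient.mk K)
  let ρ : R ⧸ I ^ (d + 1) →+* (R ⧸ K) ⧸ I' ^ (d + 1) :=
    Ideal.quotientMap _ (Ideal.Quotient.mk K) (by
      rw [← Ideal.map_le_iff_le_comap, Ideal.map_pow])
  let τ : AdicCompletion J B →+* (R ⧸ K) ⧸ I' ^ (d + 1) :=
    ρ.comp (mapQuotient hψ (d + 1) : AdicCompletion J B →+* R ⧸ I ^ (d + 1))
  have hτ (x : AdicCompletion J B) (hx : evalₐ J 1 x = 0) : τ x = 0 := by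
    have h1 : m.map (algebraMap A (AdicCompletion J B)) ≤ RingHom.ker τ := by
      rw [Ideal.map_le_iff_le_comap]
      intro a ha
      have h2 : Ideal.Quotient.mk K (algebraMap A R a) = 0 :=
        Ideal.Quotient.eq_zero_iff_mem.mpr (Ideal.mem_map_of_mem _ ha)
      change ρ (mapQuotient hψ (d + 1) (algebraMap A _ a)) = 0
      rw [AlgHom.commutes]
      change Ideal.Quotient.mk _ (Ideal.Quotient.mk K (algebraMap A R a)) = 0
      rw [h2, _root_.map_zero]
    exact h1 (hker x hx)
  let p := (truncTotal (d + 1) f).map τ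
  have hp (γ : σ →₀ ℕ) (hγ : γ.degree ≠ d) : p.coeff γ = 0 := by
    rw [MvPolynomial.coeff_map]
    obtain h | h := lt_or_gt_of_ne hγ
    · rw [coeff_truncTotal _ (by omega)]
      exact hτ _ (ih _ h γ rfl)
    · rw [coeff_truncTotal_eq_zero _ (by omega), _root_.map_zero]
  obtain ⟨F₀, hF₀⟩ := MvPolynomial.map_surjective (σ := σ) _
    (Ideal.Quotient.mk_surjective (I := I' ^ (d + 1))) p
  -- The lift `F₀` need not be homogeneous, but its other components vanish modulo `I' ^ (d + 1)`,
  -- so dropping them still leaves a lift of `p`.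
  let F := MvPolynomial.homogeneousComponent d F₀
  have hF : MvPolynomial.map (Ideal.Quotient.mk (I' ^ (d + 1))) F = p := by
    ext γ
    rw [MvPolynomial.coeff_map, MvPolynomial.coeff_homogeneousComponent]
    split_ifs with h
    · rw [← MvPolynomial.coeff_map, hF₀]
    · rw [_root_.map_zero, hp γ h]
  have hev : Ideal.Quotient.mk (I' ^ (d + 1))
      (MvPolynomial.eval (fun s ↦ Ideal.Quotient.mk K (t s)) F) = 0 := by
    have h1 : evalQuotientPoly hψ t (d + 1) (truncTotal (d + 1) f) = 0 := by
      rw [← evalₐ_evalAdic hψ ht, hf, _root_.map_zero]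
    have h2 := congrArg ρ h1
    rw [_root_.map_zero, evalQuotientPoly, MvPolynomial.coe_eval₂Hom, MvPolynomial.eval₂_comp_left,
      MvPolynomial.eval₂_eq_eval_map] at h2
    rw [← MvPolynomial.eval₂_id, MvPolynomial.eval₂_comp_left, RingHomCompTriple.comp_eq,
      MvPolynomial.eval₂_eq_eval_map, hF]
    exact h2
  have hcoeff := hind d F (MvPolynomial.homogeneousComponent_isHomogeneous d F₀)
    (Ideal.Quotient.eq_zero_iff_mem.mp hev) β
  obtain ⟨r, hr⟩ := Ideal.Quotient.mk_surjective (mapQuotient hψ (d + 1) (coeff β f))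
  have h3 : Ideal.Quotient.mk (I' ^ (d + 1)) (F.coeff β) =
      Ideal.Quotient.mk (I' ^ (d + 1)) (Ideal.Quotient.mk K r) := by
    rw [← MvPolynomial.coeff_map, hF, MvPolynomial.coeff_map, coeff_truncTotal _ (Nat.lt_succ_self d)]
    change ρ (mapQuotient hψ (d + 1) (coeff β f)) = _
    rw [← hr]
    rfl
  rw [eq_comm, Ideal.Quotient.mk_eq_mk_iff_sub_mem] at h3
  have h4 := Ideal.add_mem _ (Ideal.pow_le_self (Nat.succ_ne_zero d) h3) hcoeff
  rw [sub_add_cancel, Ideal.mem_quotient_iff_mem hmI] at h4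
  refine hinj _ ?_
  rw [← factor_mapQuotient hψ (Nat.le_add_left 1 d), ← hr, Ideal.Quotient.factor_mk,
    Ideal.Quotient.eq_zero_iff_mem, pow_one]
  exact h4

theorem evalAdic_injective [Module.Flat A (AdicCompletion I R)] {m : Ideal A} (hm : m.FG)
    (hmI : m.map (algebraMap A R) ≤ I) (hmJ : m.map (algebraMap A B) ≤ J)
    (hker : ∀ x : AdicCompletion J B, evalₐ J 1 x = 0 → x ∈ m.map (algebraMap A _))
    (hinj : ∀ x, mapQuotient hψ 1 x = 0 → evalₐ J 1 x = 0)
    (hind : ∀ (d : ℕ) (F : MvPolynomial σ (R ⧸ m.map (algebraMap A R))), F.IsHomogeneous d →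
      MvPolynomial.eval (fun s ↦ Ideal.Quotient.mk _ (t s)) F ∈
        (I.map (Ideal.Quotient.mk (m.map (algebraMap A R)))) ^ (d + 1) →
      ∀ β, F.coeff β ∈ I.map (Ideal.Quotient.mk (m.map (algebraMap A R))))
    (hsurj : Function.Surjective (evalAdic hψ ht)) : Function.Injective (evalAdic hψ ht) := by
  -- Surjectivity presents the flat algebra `R̂` as the quotient of the power series ring by this
  -- kernel.
  have hN : RingHom.ker (evalAdic hψ ht) ≤
      m.map (algebraMap A (MvPowerSeries σ (AdicCompletion J B))) * RingHom.ker (evalAdic hψ ht) :=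
    fun f hf ↦ Module.Flat.mem_map_mul_ker hsurj (mem_map_of_forall_coeff_mem hm fun β ↦ hker _
      (evalₐ_coeff_eq_zero_of_evalAdic_eq_zero hψ ht hmI hker hinj hind hf β)) hf
  rw [injective_iff_map_eq_zero]
  intro f hf
  refine MvPowerSeries.ext fun β ↦ ?_
  refine ext_evalₐ (I := J) fun i ↦ ?_
  have h1 : f ∈ (m ^ i).map (algebraMap A (MvPowerSeries σ (AdicCompletion J B))) := by
    rw [Ideal.map_pow]
    exact Ideal.le_pow_of_le_mul hN i hf
  have h2 : (m ^ i).map (algebraMap A (MvPowerSeries σ (AdicCompletion J B))) ≤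
      RingHom.ker (MvPowerSeries.map (σ := σ) (evalₐ J i : AdicCompletion J B →+* B ⧸ J ^ i)) := by
    rw [Ideal.map_le_iff_le_comap]
    intro a ha
    have h3 : algebraMap A B a ∈ J ^ i := by
      have := Ideal.mem_map_of_mem (algebraMap A B) ha
      rw [Ideal.map_pow] at this
      exact Ideal.pow_right_mono hmJ i this
    rw [Ideal.mem_comap, RingHom.mem_ker, algebraMap_apply, map_C]
    have h4 : evalₐ J i (algebraMap A _ a) = 0 :=
      (((evalₐ J i).restrictScalars A).commutes a).trans (Ideal.Quotient.eq_zero_iff_mem.mpr h3)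
    exact (congrArg C h4).trans (_root_.map_zero _)
  have h5 := congrArg (coeff β) (RingHom.mem_ker.mp (h2 h1))
  rw [coeff_map] at h5
  refine h5.trans ?_
  simp

end MvPowerSeries

/-! ### Parameters of the fibre and the isomorphism. -/

open IsLocalRing

theorem IsLocalRing.formallySmooth_quotient_map_maximalIdeal {A B : Type*} [CommRing A]
    [CommRing B] [IsLocalRing A] [IsLocalRing B] [Algebra A B] [IsLocalHom (algebraMap A B)]
    (hJ : (maximalIdeal A).map (algebraMap A B) = maximalIdeal B)
    [h : Algebra.FormallySmooth (ResidueField A) (ResidueField B)] :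
    Algebra.FormallySmooth (A ⧸ maximalIdeal A) (B ⧸ (maximalIdeal A).map (algebraMap A B)) := by
  let : Algebra (A ⧸ maximalIdeal A) (ResidueField B) :=
    inferInstanceAs (Algebra (ResidueField A) (ResidueField B))
  have : Algebra.FormallySmooth (A ⧸ maximalIdeal A) (ResidueField B) := h
  let e : ResidueField B ≃ₐ[A ⧸ maximalIdeal A] (B ⧸ (maximalIdeal A).map (algebraMap A B)) :=
    AlgEquiv.ofRingEquiv (f := (Ideal.quotEquivOfEq hJ.symm : ResidueField B ≃+* _)) (fun a ↦ by
      obtain ⟨a, rfl⟩ := Ideal.Quotient.mk_surjective a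
      rfl)
  exact .of_equiv e

theorem IsRegularLocalRing.exists_span_range_eq_maximalIdeal {R : Type*} [CommRing R]
    [IsRegularLocalRing R] {n : ℕ} (hn : ringKrullDim R = n) :
    ∃ t : Fin n → R, Ideal.span (Set.range t) = maximalIdeal R := by
  obtain ⟨s, hs, hs'⟩ := Submodule.FG.exists_span_finset_card_eq_spanFinrank
    (maximalIdeal R).fg_of_isNoetherianRing
  have h : s.card = n := by
    rw [hs]
    exact_mod_cast (IsRegularLocalRing.spanFinrank_maximalIdeal (R := R)).trans hn
  refine ⟨fun i ↦ (s.equivFinOfCardEq h).symm i, ?_⟩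
  rw [← hs', Ideal.span]
  congr 1
  ext x
  simp only [Set.mem_range, Finset.mem_coe]
  exact ⟨fun ⟨i, hi⟩ ↦ hi ▸ Subtype.prop _, fun hx ↦ ⟨s.equivFinOfCardEq h ⟨x, hx⟩, by simp⟩⟩

theorem IsLocalRing.exists_regular_parameters_of_isRegularRing_tensorProduct {A R : Type*}
    [CommRing A] [CommRing R] [IsLocalRing A] [IsLocalRing R] [IsNoetherianRing R] [Algebra A R]
    [IsLocalHom (algebraMap A R)] (hreg : IsRegularRing (R ⊗[A] ResidueField A)) {n : ℕ}
    (hn : ringKrullDim (R ⊗[A] ResidueField A) = n) :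
    ∃ t : Fin n → R,
      maximalIdeal R = (maximalIdeal A).map (algebraMap A R) ⊔ Ideal.span (Set.range t) ∧
      ∀ (d : ℕ) (F : MvPolynomial (Fin n) (R ⧸ (maximalIdeal A).map (algebraMap A R))),
        F.IsHomogeneous d → MvPolynomial.eval (fun s ↦ Ideal.Quotient.mk _ (t s)) F ∈
          ((maximalIdeal R).map
            (Ideal.Quotient.mk ((maximalIdeal A).map (algebraMap A R)))) ^ (d + 1) →
        ∀ β, F.coeff β ∈ (maximalIdeal R).map
          (Ideal.Quotient.mk ((maximalIdeal A).map (algebraMap A R))) := by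
  set K := (maximalIdeal A).map (algebraMap A R)
  have hK : K ≤ maximalIdeal R :=
    ((local_hom_TFAE (algebraMap A R)).out 0 2 rfl rfl).mp inferInstance
  have : Nontrivial (R ⧸ K) := Ideal.Quotient.nontrivial_iff.mpr
    (hK.trans_lt (inferInstance : (maximalIdeal R).IsMaximal).lt_top).ne
  have : IsLocalRing (R ⧸ K) := .of_surjective' (Ideal.Quotient.mk K) Ideal.Quotient.mk_surjective
  let e : (R ⧸ K) ≃+* R ⊗[A] ResidueField A :=
    (Algebra.TensorProduct.quotIdealMapEquivTensorQuot R (maximalIdeal A)).toRingEquiv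
  have : IsRegularRing (R ⧸ K) := .of_ringEquiv e.symm
  have : IsRegularLocalRing (R ⧸ K) := .of_isRegularRing_of_isLocalRing _
  have hdim : ringKrullDim (R ⧸ K) = n := (ringKrullDim_eq_of_ringEquiv e).trans hn
  have hmax : (maximalIdeal R).map (Ideal.Quotient.mk K) = maximalIdeal (R ⧸ K) :=
    IsLocalRing.map_maximalIdeal_of_surjective _ Ideal.Quotient.mk_surjective
  obtain ⟨u, hu⟩ := IsRegularLocalRing.exists_span_range_eq_maximalIdeal hdim
  choose t ht using fun i ↦ Ideal.Quotient.mk_surjective (u i)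
  obtain rfl : (fun i ↦ Ideal.Quotient.mk K (t i)) = u := funext ht
  refine ⟨t, ?_, fun d F hF h β ↦ ?_⟩
  · have h := congrArg (Ideal.comap (Ideal.Quotient.mk K)) (hmax.trans hu.symm)
    rw [Set.range_comp' (Ideal.Quotient.mk K) t, ← Ideal.map_span, Ideal.comap_map_mk hK,
      Ideal.comap_map_of_surjective _ Ideal.Quotient.mk_surjective, ← RingHom.ker_eq_comap_bot,
      Ideal.mk_ker] at h
    rw [h, sup_comm]
  · rw [hmax] at h ⊢
    exact coeff_mem_maximalIdeal_of_isHomogeneous hdim.ge hu hF h β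

theorem AdicCompletion.mem_map_of_evalₐ_one_eq_zero {S : Type*} [CommRing S] {J : Ideal S}
    (hJ : J.FG) {x : AdicCompletion J S} (hx : evalₐ J 1 x = 0) :
    x ∈ J.map (algebraMap S (AdicCompletion J S)) := by
  refine (ker_evalOneₐ_eq_map J hJ).le ?_
  change evalOneₐ J x = 0
  rw [← factorₐ_evalₐ_one, hx, _root_.map_zero]

/-- `K / k` is a separable, not necessarily algebraic, extension of fields exactly when `K` is a
geometrically reduced `k`-algebra. -/
theorem lemmas1p6 {A R B : Type*} [CommRing A] [CommRing R] [CommRing B]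
    [IsLocalRing A] [IsLocalRing R] [IsLocalRing B]
    [IsNoetherianRing A] [IsNoetherianRing R] [IsNoetherianRing B]
    [Algebra A R] [IsLocalHom (algebraMap A R)] [Module.Flat A R]
    (hK : Algebra.IsGeometricallyReduced
      (IsLocalRing.ResidueField A) (IsLocalRing.ResidueField R))
    (hreg : IsRegularRing (R ⊗[A] IsLocalRing.ResidueField A))
    (n : ℕ) (hn : ringKrullDim (R ⊗[A] IsLocalRing.ResidueField A) = (n : WithBot ℕ∞))
    [Algebra A B] [IsLocalHom (algebraMap A B)] [Module.Flat A B]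
    (hJ : (IsLocalRing.maximalIdeal A).map (algebraMap A B) = IsLocalRing.maximalIdeal B)
    (hB : Nonempty (IsLocalRing.ResidueField B ≃ₐ[IsLocalRing.ResidueField A]
      IsLocalRing.ResidueField R)) :
    Nonempty (AdicCompletion (IsLocalRing.maximalIdeal R) R ≃ₐ[A]
      MvPowerSeries (Fin n) (AdicCompletion (IsLocalRing.maximalIdeal B) B)) := by
  obtain ⟨e⟩ := hB
  have := Algebra.FormallySmooth.of_isGeometricallyReduced (ResidueField A) (ResidueField R)
  have : Algebra.FormallySmooth (ResidueField A) (ResidueField B) := .of_equiv e.symm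
  have := formallySmooth_quotient_map_maximalIdeal hJ
  have hmI : (maximalIdeal A).map (algebraMap A R) ≤ maximalIdeal R :=
    ((local_hom_TFAE (algebraMap A R)).out 0 2 rfl rfl).mp inferInstance
  let φ : B →ₐ[A] R ⧸ maximalIdeal R :=
    (e.restrictScalars A : ResidueField B →ₐ[A] ResidueField R).comp
      (IsScalarTower.toAlgHom A B (ResidueField B))
  have hφ (b : B) : φ b = 0 ↔ b ∈ maximalIdeal B :=
    (EmbeddingLike.map_eq_zero_iff (f := e)).trans (residue_eq_zero_iff b)
  have hφs : Function.Surjective φ := e.surjective.comp residue_surjective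
  obtain ⟨ψ, hψφ⟩ := Module.Flat.exists_lift_adicCompletion hmI φ
  have hψ (b : B) (hb : b ∈ maximalIdeal B) : evalOneₐ (maximalIdeal R) (ψ b) = 0 :=
    (hψφ b).trans ((hφ b).mpr hb)
  obtain ⟨t, ht, hind⟩ := exists_regular_parameters_of_isRegularRing_tensorProduct hreg hn
  have htI (i : Fin n) : t i ∈ maximalIdeal R :=
    ht.ge (Ideal.mem_sup_right (Ideal.subset_span ⟨i, rfl⟩))
  have hsurj := MvPowerSeries.evalAdic_surjective hψ htI hJ.le ht fun r ↦ by
    obtain ⟨b, hb⟩ := hφs (Ideal.Quotient.mk _ r)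
    exact ⟨b, (hψφ b).trans hb⟩
  have : Module.Flat A (AdicCompletion (maximalIdeal R) R) := .trans A R _
  refine ⟨(AlgEquiv.ofBijective _ ⟨MvPowerSeries.evalAdic_injective hψ htI
    (maximalIdeal A).fg_of_isNoetherianRing hmI hJ.le (fun x hx ↦ ?_) (fun x hx ↦ ?_) hind hsurj,
    hsurj⟩).symm⟩
  · rw [IsScalarTower.algebraMap_eq A B, ← Ideal.map_map, hJ]
    exact mem_map_of_evalₐ_one_eq_zero (maximalIdeal B).fg_of_isNoetherianRing hx
  -- Modulo the maximal ideals the map is `φ`, whose kernel is exactly `J`; only a representative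
  -- `b` of `x` modulo `J` matters.
  · obtain ⟨b, hb⟩ := Ideal.Quotient.mk_surjective (evalₐ (maximalIdeal B) 1 x)
    have h1 : mapQuotient hψ 1 (of _ B b) = 0 := by
      rw [← hx, ← sub_eq_zero, ← map_sub]
      refine mapQuotient_eq_zero hψ ?_
      rw [map_sub, evalₐ_of, hb, sub_self]
    rw [mapQuotient_of] at h1
    have h2 : φ b = 0 := by rw [← hψφ, ← factorₐ_evalₐ_one, h1, _root_.map_zero]
    rw [← hb, Ideal.Quotient.eq_zero_iff_mem, pow_one]
    exact (hφ b).mp h2
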